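/- All graphs are finite and simple. An ordered graph is a graph together with a linear ordering of its vertices; induced subgraphs inherit the restricted ordering. A layering of a graph $G$ is a function $\lambda:V(G)\to\mathbb{Z}$ such that $|\lambda(u)-\lambda(v)|\le 1$ for every edge $uv\in E(G)$. The Baker game is played by Destroyer and Preserver on states $(G,\mathbf{r})$, where $G$ is an ordered graph and $\mathbf{r}=r_1,r_2,\ldots$ is an infinite sequence of non-negative integers. If $V(G)=\emptyset$, the game stops. Otherwise, in each round Destroyer chooses one of two actions. In the action Delete, the smallest vertex $v$ of $G$ is removed, and the game proceeds with the state $(G-v,\mathbf{r}')$, where $\mathbf{r}'=r_2,r_3,\ldots$. In the action Restrict, Destroyer selects a layering $\lambda$ of $G$, Preserver selects a set $I$ of at most $r_1$ consecutive integers, and the game proceeds with the state $(G[\lambda^{-1}(I)],\mathbf{r}')$. Destroyer wins in $t$ rounds on $(G,\mathbf{r})$ if he can ensure that, however Preserver plays, the game stops after at most $t$ rounds. A class $\mathcal{C}$ of ordered graphs is a Baker class if for every infinite sequence $\mathbf{r}$ of non-negative integers there exists an integer $t\ge 0$ such that for every $G\in\mathcal{C}$, Destroyer wins the Baker game on $(G,\mathbf{r})$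 in $t$ rounds. Corollary. For every integer $k\ge 1$, there exists a Baker class $\mathcal{K}_k$ such that every graph that does not contain the complete graph $K_k$ as a minor, together with some linear ordering of its vertices, belongs to $\mathcal{K}_k$. -/

import Mathlib

universe u v

/-- A finite ordered graph: a finite simple graph together with a linear ordering of its
vertices. -/
structure OrderedGraph : Type (u + 1) where
  /-- The vertex set. -/
  V : Type u
  /-- The vertex set is finite. -/
  fin : Finite V
  /-- The linear ordering of the vertices. -/
  ord : LinearOrder V
  /-- The underlying graph. -/
  graph : SimpleGraph V

namespace OrderedGraph

/-- The ordered graph `G[S]` induced by a set `S` of vertices, with the restricted ordering. -/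
def induce (G : OrderedGraph.{u}) (S : Set G.V) : OrderedGraph.{u} where
  V := S
  fin := haveI := G.fin; inferInstance
  ord := letI := G.ord; inferInstance
  graph := G.graph.induce S

/-- `v` is the smallest vertex of `G`. -/
def IsSmallest (G : OrderedGraph.{u}) (v : G.V) : Prop :=
  ∀ w : G.V, G.ord.le v w

end OrderedGraph

/-- A layering of a graph: an integer labelling of the vertices under which adjacent vertices
have labels differing by at most one. -/
def IsLayering {V : Type u} (G : SimpleGraph V) (lam : V → ℤ) : Prop :=
  ∀ x y : V, G.Adj x y → |lam x - lam y| ≤ 1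

/-- The sequence with its first term removed. Sequences are indexed from `0`, so the head of `r`
is `r 0`. -/
def seqTail (r : ℕ → ℕ) : ℕ → ℕ := fun i => r (i + 1)

/-- Destroyer wins the Baker game on the state `(G, r)` in `t` rounds. If the vertex set is empty,
the game stops. Otherwise Destroyer either deletes the smallest vertex, or selects a layering, in
which case Preserver selects a set `{a, …, a + l - 1}` of `l ≤ r 0` consecutive integers and only
the vertices in these layers are kept. In both cases the game goes on with the tail of `r`. -/
def DestroyerWins : ℕ → OrderedGraph.{u} → (ℕ → ℕ) → Prop
  | 0, G, _ => IsEmpty G.V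
  | t + 1, G, r =>
      IsEmpty G.V ∨
      (∃ v : G.V, G.IsSmallest v ∧ DestroyerWins t (G.induce {w | w ≠ v}) (seqTail r)) ∨
      (∃ lam : G.V → ℤ, IsLayering G.graph lam ∧
        ∀ (a : ℤ) (l : ℕ), l ≤ r 0 →
          DestroyerWins t (G.induce {w | lam w ∈ Set.Ico a (a + (l : ℤ))}) (seqTail r))

/-- A Baker class: a class of ordered graphs such that, for every sequence `r`, there is a number
`t` of rounds within which Destroyer wins on `(G, r)` for all members `G` of the class. -/
def IsBakerClass (C : Set OrderedGraph.{u}) : Prop :=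
  ∀ r : ℕ → ℕ, ∃ t : ℕ, ∀ G ∈ C, DestroyerWins t G r

/-- `H` is a minor of `G`: there are pairwise disjoint vertex sets of `G`, one for each vertex of
`H`, each inducing a connected (in particular non-empty) subgraph of `G`, such that the sets of
adjacent vertices of `H` are joined by an edge of `G`. -/
def IsMinor {W : Type v} {V : Type u} (H : SimpleGraph W) (G : SimpleGraph V) : Prop :=
  ∃ B : W → Set V,
    (∀ x, (G.induce (B x)).Connected) ∧
    (∀ x y, x ≠ y → Disjoint (B x) (B y)) ∧
    (∀ x y, H.Adj x y → ∃ a ∈ B x, ∃ b ∈ B y, G.Adj a b)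

/-! Structure: a `K_k`-minor-free graph is cut into parts by repeatedly splitting off a connected
set `B` from a component `C` of what is left. The earlier parts joined to `C` are pairwise joined,
so together with `C` they form a complete minor and number at most `k - 2`. Let `B` be a union of
geodesics of `C` from one root, one to a neighbour of each of these parts. Then `B` has few vertices
at each distance from the root, and whatever remains of `C` still sees pairwise joined parts
(`IsPartialPartition.extend`). The vertices are ordered part by part.

Game: on such a partition Destroyer's number of rounds depends only on `k` and `r`, by induction on
a bound `ω` for the number of earlier neighbours of a part (`exists_canClear`). If the parts to be
cleared are pairwise unjoined, Destroyer isolates one of them, cuts it down to boundedly many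
vertices by its layering, and deletes these. Otherwise he plays the layering `depthIn`: inside one
layer every part to be cleared has lost an earlier neighbour, and edges between different layers go
up, so the surviving layers can be cleared one by one from the lowest (`exists_clear_layers`). -/

/-! ### The game on subsets of a fixed vertex set -/

/-- Destroyer wins the Baker game in `t` rounds on the subgraph of `G` induced by `S`. -/
def WinsOn {V : Type u} [LinearOrder V] (G : SimpleGraph V) : ℕ → Set V → (ℕ → ℕ) → Prop
  | 0, S, _ => S = ∅
  | t + 1, S, r =>
      S = ∅ ∨
      (∃ v ∈ S, (∀ w ∈ S, v ≤ w) ∧ WinsOn G t (S \ {v}) (seqTail r)) ∨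
      (∃ lam : V → ℤ, (∀ x ∈ S, ∀ y ∈ S, G.Adj x y → |lam x - lam y| ≤ 1) ∧
        ∀ (a : ℤ) (l : ℕ), l ≤ r 0 →
          WinsOn G t (S ∩ {w | lam w ∈ Set.Ico a (a + (l : ℤ))}) (seqTail r))

/-- The sequence with its first `n` terms removed. -/
def seqDrop (n : ℕ) (r : ℕ → ℕ) : ℕ → ℕ := fun i => r (n + i)

theorem seqDrop_zero (r : ℕ → ℕ) : seqDrop 0 r = r := by
  funext i; simp [seqDrop]

theorem seqDrop_succ (n : ℕ) (r : ℕ → ℕ) : seqDrop (n + 1) r = seqDrop n (seqTail r) := by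
  funext i; simp only [seqDrop, seqTail]; congr 1; omega

theorem seqDrop_seqDrop (m n : ℕ) (r : ℕ → ℕ) :
    seqDrop m (seqDrop n r) = seqDrop (n + m) r := by
  funext i; simp only [seqDrop]; congr 1; omega

/-- Lets the strategy be described with subsets of one ordered type instead of iterated subtypes;
`f` embeds the current state. -/
theorem destroyerWins_of_winsOn {V : Type u} [LinearOrder V] {G : SimpleGraph V} :
    ∀ (t : ℕ) (H : OrderedGraph.{u}) (f : H.V → V) (r : ℕ → ℕ),
      (∀ x y, H.ord.le x y ↔ f x ≤ f y) → (∀ x y, H.graph.Adj x y → G.Adj (f x) (f y)) →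
      WinsOn G t (Set.range f) r → DestroyerWins t H r := by
  intro t
  induction t with
  | zero =>
    intro H f r _ _ h
    exact Set.range_eq_empty_iff.1 h
  | succ t ih =>
    intro H f r hf hadj h
    have hinj : Function.Injective f := fun x y hxy =>
      H.ord.le_antisymm _ _ ((hf x y).2 hxy.le) ((hf y x).2 hxy.ge)
    rcases h with h | ⟨v, ⟨x, rfl⟩, hmin, h⟩ | ⟨lam, hlam, h⟩
    · exact Or.inl (Set.range_eq_empty_iff.1 h)
    · refine Or.inr (Or.inl ⟨x, fun w => (hf x w).2 (hmin _ ⟨w, rfl⟩), ?_⟩)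
      refine ih (H.induce {w | w ≠ x}) (fun w => f w.1) _ (fun a b => hf a.1 b.1)
        (fun a b hab => hadj a.1 b.1 hab) ?_
      convert h using 1
      ext z
      constructor
      · rintro ⟨w, rfl⟩
        exact ⟨⟨w.1, rfl⟩, fun hw => w.2 (hinj hw)⟩
      · rintro ⟨⟨w, rfl⟩, hw⟩
        exact ⟨⟨w, fun e => hw (congrArg f e)⟩, rfl⟩
    · refine Or.inr (Or.inr ⟨fun w => lam (f w),
        fun x y hxy => hlam _ ⟨x, rfl⟩ _ ⟨y, rfl⟩ (hadj x y hxy), fun a l hl => ?_⟩)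
      refine ih (H.induce _) (fun w => f w.1) _ (fun a b => hf a.1 b.1)
        (fun a b hab => hadj a.1 b.1 hab) ?_
      convert h a l hl using 1
      ext z
      constructor
      · rintro ⟨w, rfl⟩
        exact ⟨⟨w.1, rfl⟩, w.2⟩
      · rintro ⟨⟨w, rfl⟩, hw⟩
        exact ⟨⟨w, hw⟩, rfl⟩

section Game

variable {V : Type u} [LinearOrder V] {G : SimpleGraph V}

theorem winsOn_empty (t : ℕ) (r : ℕ → ℕ) : WinsOn G t ∅ r := by
  cases t with
  | zero => exact rfl
  | succ t => exact Or.inl rfl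

theorem WinsOn.mono {t : ℕ} {S S' : Set V} {r : ℕ → ℕ} (hS : S ⊆ S') (h : WinsOn G t S' r) :
    WinsOn G t S r := by
  induction t generalizing S S' r with
  | zero => exact Set.subset_eq_empty hS h
  | succ t ih =>
    rcases h with h | ⟨v, hv, hmin, h⟩ | ⟨lam, hlam, h⟩
    · exact Or.inl (Set.subset_eq_empty hS h)
    · by_cases hvS : v ∈ S
      · exact Or.inr (Or.inl ⟨v, hvS, fun w hw => hmin w (hS hw),
          ih (Set.sdiff_subset_sdiff_left hS) h⟩)
      -- The vertex to be deleted is already missing, so a constant layering uses up the round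
      -- instead.
      · refine Or.inr (Or.inr ⟨fun _ => 0, fun _ _ _ _ _ => by simp, fun a l _ => ih ?_ h⟩)
        exact fun x hx => ⟨hS hx.1, fun e => hvS (e ▸ hx.1)⟩
    · exact Or.inr (Or.inr ⟨lam, fun x hx y hy => hlam x (hS hx) y (hS hy),
        fun a l hl => ih (Set.inter_subset_inter_left _ hS) (h a l hl)⟩)

theorem WinsOn.restrict {t : ℕ} {S : Set V} {r : ℕ → ℕ} (lam : V → ℤ)
    (hlam : ∀ x ∈ S, ∀ y ∈ S, G.Adj x y → |lam x - lam y| ≤ 1)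
    (h : ∀ a : ℤ, WinsOn G t (S ∩ {w | lam w ∈ Set.Ico a (a + (r 0 : ℤ))}) (seqTail r)) :
    WinsOn G (t + 1) S r := by
  refine Or.inr (Or.inr ⟨lam, hlam, fun a l hl => (h a).mono ?_⟩)
  refine fun x hx => ⟨hx.1, hx.2.1, ?_⟩
  have := hx.2.2
  have : (l : ℤ) ≤ r 0 := by exact_mod_cast hl
  omega

/-- Wasting rounds makes each phase last a number of rounds fixed in advance, so that the next phase
starts from a known tail of `r`. -/
theorem WinsOn.pass {t : ℕ} (n : ℕ) {S : Set V} {r : ℕ → ℕ} (h : WinsOn G t S (seqDrop n r)) :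
    WinsOn G (n + t) S r := by
  induction n generalizing r with
  | zero => simpa [seqDrop_zero] using h
  | succ n ih =>
    rw [seqDrop_succ] at h
    rw [Nat.add_right_comm]
    exact WinsOn.restrict (fun _ => 0) (fun _ _ _ _ _ => by simp)
      fun a => (ih h).mono Set.inter_subset_left

theorem WinsOn.restrict_fiber {t : ℕ} {S : Set V} {r : ℕ → ℕ} (c : V → ℕ)
    (hc : ∀ x ∈ S, ∀ y ∈ S, G.Adj x y → c x = c y)
    (h : ∀ n, WinsOn G t (S ∩ {w | c w = n}) (seqTail r)) :
    WinsOn G (t + 1) S r := by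
  -- Distinct labels are more than `r 0` apart, so Preserver's interval meets at most one fibre of
  -- `c`.
  refine WinsOn.restrict (fun x => (c x : ℤ) * (r 0 + 1)) (fun x hx y hy hxy => ?_) fun a => ?_
  · simp [hc x hx y hy hxy]
  · by_cases hne : (S ∩ {w | (c w : ℤ) * (r 0 + 1) ∈ Set.Ico a (a + (r 0 : ℤ))}).Nonempty
    · obtain ⟨x, -, hx1, hx2⟩ := hne
      refine (h (c x)).mono ?_
      refine fun y hy => ⟨hy.1, ?_⟩
      obtain ⟨-, hy1, hy2⟩ := hy
      have h0 : (0 : ℤ) ≤ r 0 := by positivity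
      have h1 : (c y : ℤ) < c x + 1 := by
        by_contra! hlt
        nlinarith
      have h2 : (c x : ℤ) < c y + 1 := by
        by_contra! hlt
        nlinarith
      show c y = c x
      omega
    · rw [Set.not_nonempty_iff_eq_empty.1 hne]
      exact winsOn_empty _ _

theorem WinsOn.delete [Finite V] {t : ℕ} (n : ℕ) {S B : Set V} {r : ℕ → ℕ}
    (hB : (S ∩ B).ncard ≤ n) (hlt : ∀ x ∈ S, x ∈ B → ∀ y ∈ S, y ∉ B → x ≤ y)
    (h : WinsOn G t (S \ B) (seqDrop n r)) : WinsOn G (n + t) S r := by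
  induction n generalizing S r with
  | zero =>
    have : S ∩ B = ∅ := by
      rwa [← Set.ncard_eq_zero, ← Nat.le_zero]
    have hS : S ⊆ S \ B := fun x hx => ⟨hx, fun hxB => by
      have : x ∈ S ∩ B := ⟨hx, hxB⟩
      simp_all⟩
    simpa [seqDrop_zero] using h.mono hS
  | succ n ih =>
    by_cases hne : (S ∩ B).Nonempty
    · obtain ⟨v, hv, hmin⟩ := Set.exists_min_image (S ∩ B) id (Set.toFinite _) hne
      rw [Nat.add_right_comm]
      refine Or.inr (Or.inl ⟨v, hv.1, fun w hw => ?_, ih ?_ ?_ ?_⟩)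
      · by_cases hwB : w ∈ B
        · exact hmin w ⟨hw, hwB⟩
        · exact hlt v hv.1 hv.2 w hw hwB
      · have : (S \ {v}) ∩ B = (S ∩ B) \ {v} := by
          ext x; simp only [Set.mem_inter_iff, Set.mem_sdiff]; tauto
        rw [this, Set.ncard_sdiff_singleton_of_mem hv]
        omega
      · exact fun x hx hxB y hy hyB => hlt x hx.1 hxB y hy.1 hyB
      · rw [← seqDrop_succ]
        exact h.mono (Set.sdiff_subset_sdiff_left Set.sdiff_subset)
    · have hS : S ⊆ S \ B := fun x hx => ⟨hx, fun hxB => hne ⟨x, hx, hxB⟩⟩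
      exact WinsOn.pass _ (h.mono hS)

end Game

/-! ### Thin partitions; roots and depths in chordal orders -/

/-- The parts `h ⁻¹ {i}` and `h ⁻¹ {j}` are joined by an edge, and `i < j`. -/
def BackAdj {V : Type u} (G : SimpleGraph V) (h : V → ℕ) (i j : ℕ) : Prop :=
  i < j ∧ ∃ x y, h x = i ∧ h y = j ∧ G.Adj x y

/-- A partition of the vertices into indexed parts such that the earlier parts joined to a given
part are fewer than `k` and pairwise joined, and such that each part meets every layer of some
layering of the graph induced by this part and the later ones in at most `k` vertices. -/
structure IsThinPartition {V : Type u} (G : SimpleGraph V) (h : V → ℕ) (k : ℕ) : Prop where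
  chordal : ∀ i j l, BackAdj G h i l → BackAdj G h j l → i < j → BackAdj G h i j
  ncard_lt : ∀ l, {i | BackAdj G h i l}.ncard < k
  layering : ∀ i, ∃ lam : V → ℤ,
    (∀ x y, i ≤ h x → i ≤ h y → G.Adj x y → |lam x - lam y| ≤ 1) ∧
    ∀ n, {x | h x = i ∧ lam x = n}.ncard ≤ k

/-- A relation on the natural numbers that only relates smaller to larger numbers, and under which
any two lower neighbours of a number are related. -/
structure IsChordalOrder (R : ℕ → ℕ → Prop) : Prop where
  lt : ∀ {i j}, R i j → i < j
  chordal : ∀ {i j l}, R i l → R j l → i < j → R i j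

theorem BackAdj.isChordalOrder {V : Type u} {G : SimpleGraph V} {h : V → ℕ} {k : ℕ}
    (hG : IsThinPartition G h k) (D : Set ℕ) :
    IsChordalOrder fun i j => BackAdj G h i j ∧ i ∈ D ∧ j ∈ D where
  lt h := h.1.1
  chordal h h' hij := ⟨hG.chordal _ _ _ h.1 h'.1 hij, h.2.1, h'.2.1⟩

/-- The smallest number that can be reached by going down along `R`. -/
noncomputable def rootOf (R : ℕ → ℕ → Prop) (j : ℕ) : ℕ :=
  sInf (insert j (Set.range fun i : {i // i < j ∧ R i j} => rootOf R i.1))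
termination_by j
decreasing_by exact i.2.1

theorem rootOf_le (R : ℕ → ℕ → Prop) (j : ℕ) : rootOf R j ≤ j := by
  rw [rootOf]
  exact Nat.sInf_le (Set.mem_insert _ _)

theorem rootOf_eq_self {R : ℕ → ℕ → Prop} {j : ℕ} (h : ∀ i, ¬ R i j) : rootOf R j = j := by
  rw [rootOf]
  have : IsEmpty {i // i < j ∧ R i j} := ⟨fun i => h _ i.2.2⟩
  simp [Set.range_eq_empty]

/-- The root of `j` comes from some lower neighbour `z`. By chordality `z` and `i` are equal or
related, and induction identifies their roots. -/
theorem IsChordalOrder.rootOf_eq {R : ℕ → ℕ → Prop} (hR : IsChordalOrder R) :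
    ∀ {j i : ℕ}, R i j → rootOf R i = rootOf R j := by
  intro j
  induction j using Nat.strong_induction_on with
  | _ j ih =>
    intro i hij
    have hmem := Nat.sInf_mem (Set.insert_nonempty j
      (Set.range fun i : {i // i < j ∧ R i j} => rootOf R i.1))
    have hle : rootOf R j ≤ rootOf R i := by
      rw [rootOf.eq_1 R j]
      exact Nat.sInf_le (Or.inr ⟨⟨i, hR.lt hij, hij⟩, rfl⟩)
    rw [← rootOf.eq_1 R j] at hmem
    rcases hmem with hj | ⟨⟨z, hzj, hz⟩, hj⟩
    · have := rootOf_le R i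
      have := hR.lt hij
      omega
    · simp only at hj
      rw [← hj]
      rcases lt_trichotomy i z with h | rfl | h
      · exact ih z hzj (hR.chordal hij hz h)
      · rfl
      · exact (ih i (hR.lt hij) (hR.chordal hz hij h)).symm

open Classical in
/-- The least number of elements of `A` on a maximal path going down along `R`. -/
noncomputable def depthIn (R : ℕ → ℕ → Prop) (A : Set ℕ) (j : ℕ) : ℕ :=
  (if j ∈ A then 1 else 0) +
    sInf (Set.range fun i : {i // i < j ∧ R i j} => depthIn R A i.1)
termination_by j
decreasing_by exact i.2.1

open Classical in
theorem IsChordalOrder.depthIn_le {R : ℕ → ℕ → Prop} (hR : IsChordalOrder R) (A : Set ℕ)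
    {i j : ℕ} (hij : R i j) : depthIn R A j ≤ depthIn R A i + if j ∈ A then 1 else 0 := by
  rw [depthIn.eq_1 R A j, add_comm]
  gcongr
  exact Nat.sInf_le ⟨⟨i, hR.lt hij, hij⟩, rfl⟩

open Classical in
theorem IsChordalOrder.exists_depthIn_eq {R : ℕ → ℕ → Prop} (hR : IsChordalOrder R) (A : Set ℕ)
    {i j : ℕ} (hij : R i j) :
    ∃ z, R z j ∧ depthIn R A j = depthIn R A z + if j ∈ A then 1 else 0 := by
  have hmem := Nat.sInf_mem (s := Set.range fun i : {i // i < j ∧ R i j} => depthIn R A i.1)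
    ⟨_, ⟨i, hR.lt hij, hij⟩, rfl⟩
  obtain ⟨⟨z, hzj, hz⟩, h⟩ := hmem
  refine ⟨z, hz, ?_⟩
  rw [depthIn.eq_1 R A j, ← h, add_comm]

open Classical in
-- Compare `i` with a lower neighbour `z` of `j` attaining the minimum: by chordality they are equal
-- or related. Together with `depthIn_le` this makes the depth a layering.
theorem IsChordalOrder.depthIn_add_le {R : ℕ → ℕ → Prop} (hR : IsChordalOrder R) (A : Set ℕ) :
    ∀ {j i : ℕ}, R i j → (depthIn R A i + if j ∈ A then 1 else 0) ≤
      depthIn R A j + if i ∈ A then 1 else 0 := by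
  intro j
  induction j using Nat.strong_induction_on with
  | _ j ih =>
    intro i hij
    obtain ⟨z, hz, hj⟩ := hR.exists_depthIn_eq A hij
    rw [hj]
    rcases lt_trichotomy i z with h | rfl | h
    · have := ih z (hR.lt hz) (hR.chordal hij hz h)
      omega
    · omega
    · have := hR.depthIn_le A (hR.chordal hz hij h)
      omega

theorem IsChordalOrder.abs_depthIn_sub_le {R : ℕ → ℕ → Prop} (hR : IsChordalOrder R) (A : Set ℕ)
    {i j : ℕ} (hij : R i j) :
    |(depthIn R A i : ℤ) - depthIn R A j| ≤ 1 := by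
  classical
  have h1 := hR.depthIn_le A hij
  have h2 := hR.depthIn_add_le A hij
  rw [abs_le]
  split_ifs at h1 h2 <;> omega

theorem IsChordalOrder.depthIn_mono {R : ℕ → ℕ → Prop} (hR : IsChordalOrder R) (A : Set ℕ)
    {i j : ℕ} (hij : R i j) (hj : j ∈ A) :
    depthIn R A i ≤ depthIn R A j := by
  classical
  have h2 := hR.depthIn_add_le A hij
  simp only [hj, if_true] at h2
  split_ifs at h2 <;> omega

theorem IsChordalOrder.exists_depthIn_add_one {R : ℕ → ℕ → Prop} (hR : IsChordalOrder R)
    (A : Set ℕ) {i j : ℕ} (hij : R i j) (hj : j ∈ A) :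
    ∃ z, R z j ∧ depthIn R A j = depthIn R A z + 1 := by
  classical
  simpa [hj] using hR.exists_depthIn_eq A hij

/-! ### Destroyer's strategy on a thin partition -/

/-- Within `t` rounds on `r`, Destroyer can get rid of all parts indexed by `A`, playing on parts
indexed by `A` and `E`, provided that the edges between `A` and `E` go up and that every part
indexed by `A` is joined to fewer than `ω` earlier ones. -/
def CanClear (k ω : ℕ) (r : ℕ → ℕ) (t : ℕ) : Prop :=
  ∀ (V : Type u) [LinearOrder V] [Finite V] (G : SimpleGraph V) (h : V → ℕ),
    (∀ x y, x ≤ y → h x ≤ h y) → IsThinPartition G h k →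
    ∀ A E : Set ℕ, (∀ i ∈ E, ∀ j ∈ A, ¬ BackAdj G h i j) →
      (∀ j ∈ A, {i | i ∈ A ∧ BackAdj G h i j}.ncard < ω) →
      ∀ (s : ℕ) (S : Set V), (∀ x ∈ S, h x ∈ A ∨ h x ∈ E) →
        (∀ S' : Set V, (∀ x ∈ S', h x ∈ E) → WinsOn G s S' (seqDrop t r)) →
        WinsOn G (t + s) S r

theorem backAdj_or_eq_or {V : Type u} {G : SimpleGraph V} (h : V → ℕ) {x y : V}
    (hxy : G.Adj x y) : BackAdj G h (h x) (h y) ∨ h x = h y ∨ BackAdj G h (h y) (h x) := by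
  rcases lt_trichotomy (h x) (h y) with hlt | heq | hlt
  · exact Or.inl ⟨hlt, x, y, rfl, rfl, hxy⟩
  · exact Or.inr (Or.inl heq)
  · exact Or.inr (Or.inr ⟨hlt, y, x, rfl, rfl, hxy.symm⟩)

theorem setOf_backAdj_finite {V : Type u} (G : SimpleGraph V) (h : V → ℕ) (A : Set ℕ) (j : ℕ) :
    {i | i ∈ A ∧ BackAdj G h i j}.Finite :=
  (Set.finite_lt_nat j).subset fun _ hi => hi.2.1

theorem ncard_layers_le {V : Type u} [Finite V] (lam : V → ℤ) (B : Set V) (k : ℕ)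
    (hB : ∀ n, {x | x ∈ B ∧ lam x = n}.ncard ≤ k) (a : ℤ) (m : ℕ) :
    {x | x ∈ B ∧ lam x ∈ Set.Ico a (a + (m : ℤ))}.ncard ≤ m * k := by
  induction m with
  | zero =>
    have : {x | x ∈ B ∧ lam x ∈ Set.Ico a (a + ((0 : ℕ) : ℤ))} = ∅ := by
      ext x; simp
    rw [this]; simp
  | succ m ih =>
    have hsub : {x | x ∈ B ∧ lam x ∈ Set.Ico a (a + ((m + 1 : ℕ) : ℤ))} ⊆
        {x | x ∈ B ∧ lam x ∈ Set.Ico a (a + (m : ℤ))} ∪ {x | x ∈ B ∧ lam x = a + m} := by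
      rintro x ⟨hx, h1, h2⟩
      push_cast at h2
      by_cases hm : lam x = a + m
      · exact Or.inr ⟨hx, hm⟩
      · exact Or.inl ⟨hx, h1, by omega⟩
    calc _ ≤ _ := Set.ncard_le_ncard hsub (Set.toFinite _)
      _ ≤ _ := Set.ncard_union_le _ _
      _ ≤ m * k + k := add_le_add ih (hB _)
      _ = _ := by ring

/-- A part in `A` has no lower neighbours in `A ∪ E`, so it is its own root. One round isolates a
root, a second one leaves at most `r 1 * k` vertices of the root part, and these come first in the
ordering. -/
theorem canClear_one (k : ℕ) (r : ℕ → ℕ) : CanClear.{u} k 1 r (r 1 * k + 2) := by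
  intro V _ _ G h hmono hG A E hAE hA s S hS hwin
  have hind : ∀ i ∈ A, ∀ j ∈ A, ¬ BackAdj G h i j := by
    intro i hi j hj hij
    have := hA j hj
    rw [Nat.lt_one_iff, Set.ncard_eq_zero (setOf_backAdj_finite G h A j)] at this
    exact (Set.mem_empty_iff_false i).1 (this ▸ ⟨hi, hij⟩)
  set R : ℕ → ℕ → Prop := fun i j => BackAdj G h i j ∧ i ∈ A ∪ E ∧ j ∈ A ∪ E
  have hR : IsChordalOrder R := BackAdj.isChordalOrder hG _
  have hroot : ∀ j ∈ A, rootOf R j = j := fun j hj => rootOf_eq_self fun i hij =>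
    hij.2.1.elim (fun hi => hind i hi j hj hij.1) fun hi => hAE i hi j hj hij.1
  have e : r 1 * k + 2 + s = (r 1 * k + s + 1) + 1 := by ring
  rw [e]
  refine WinsOn.restrict_fiber (fun x => rootOf R (h x)) (fun x hx y hy hxy => ?_) fun n => ?_
  · rcases backAdj_or_eq_or h hxy with hb | hb | hb
    · exact hR.rootOf_eq ⟨hb, hS x hx, hS y hy⟩
    · rw [hb]
    · exact (hR.rootOf_eq ⟨hb, hS y hy, hS x hx⟩).symm
  -- In this fibre all parts have index at least `n`, and only part `n` can be in `A`.
  obtain ⟨lam, hlam, hcard⟩ := hG.layering n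
  have hge : ∀ x ∈ S ∩ {w | rootOf R (h w) = n}, n ≤ h x := fun x hx => by
    have h1 : rootOf R (h x) = n := hx.2
    have := rootOf_le R (h x)
    omega
  refine WinsOn.restrict lam (fun x hx y hy hxy => hlam x y (hge x hx) (hge y hy) hxy) fun a => ?_
  refine WinsOn.delete (B := {x | h x = n}) _ ?_ ?_ ?_
  · refine le_trans (Set.ncard_le_ncard ?_ (Set.toFinite _))
      (ncard_layers_le lam {x | h x = n} k hcard a (r 1))
    exact fun x hx => ⟨hx.2, hx.1.2⟩
  · intro x hx hxn y hy hyn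
    by_contra! hyx
    have h1 := hmono y x hyx.le
    have h2 := hge y hy.1
    have h3 : h x = n := hxn
    have h4 : h y ≠ n := hyn
    omega
  · rw [← seqDrop_succ, ← seqDrop_succ]
    refine hwin _ fun x hx => (hS x hx.1.1.1).resolve_left fun hxA => hx.2 ?_
    have h1 : rootOf R (h x) = n := hx.1.1.2
    rw [hroot _ hxA] at h1
    exact h1

/-- While the lowest layer is cleared, the higher layers join `E`; this is legitimate because edges
between layers go up. -/
theorem exists_clear_layers {k ω : ℕ} (hω : ∀ r, ∃ t, CanClear.{u} k ω r t) (m : ℕ) :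
    ∀ r : ℕ → ℕ, ∃ t, ∀ (V : Type u) [LinearOrder V] [Finite V] (G : SimpleGraph V) (h : V → ℕ),
      (∀ x y, x ≤ y → h x ≤ h y) → IsThinPartition G h k →
      ∀ (A : ℕ → Set ℕ) (E : Set ℕ), (∀ p, ∀ i ∈ E, ∀ j ∈ A p, ¬ BackAdj G h i j) →
        (∀ q p, q < p → ∀ i ∈ A p, ∀ j ∈ A q, ¬ BackAdj G h i j) →
        (∀ p, ∀ j ∈ A p, {i | i ∈ A p ∧ BackAdj G h i j}.ncard < ω) →
        ∀ (s : ℕ) (S : Set V), (∀ x ∈ S, (∃ p < m, h x ∈ A p) ∨ h x ∈ E) →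
          (∀ S' : Set V, (∀ x ∈ S', h x ∈ E) → WinsOn G s S' (seqDrop t r)) →
          WinsOn G (t + s) S r := by
  induction m with
  | zero =>
    refine fun r => ⟨0, fun V _ _ G h _ _ A E _ _ _ s S hS hwin => ?_⟩
    rw [zero_add]
    have := hwin S fun x hx => (hS x hx).resolve_left (by simp)
    rwa [seqDrop_zero] at this
  | succ m ih =>
    intro r
    obtain ⟨t₀, h₀⟩ := hω r
    obtain ⟨t₁, h₁⟩ := ih (seqDrop t₀ r)
    refine ⟨t₀ + t₁, fun V _ _ G h hmono hG A E hAE hAA hA s S hS hwin => ?_⟩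
    rw [add_assoc]
    refine h₀ V G h hmono hG (A 0) ({i | ∃ p < m, i ∈ A (p + 1)} ∪ E) ?_ (hA 0) _ S ?_ ?_
    · rintro i (⟨p, -, hi⟩ | hi) j hj
      · exact hAA 0 (p + 1) p.succ_pos i hi j hj
      · exact hAE 0 i hi j hj
    · intro x hx
      rcases hS x hx with ⟨p, hp, hxp⟩ | hxE
      · cases p with
        | zero => exact Or.inl hxp
        | succ p => exact Or.inr (Or.inl ⟨p, by omega, hxp⟩)
      · exact Or.inr (Or.inr hxE)
    · intro S' hS'
      refine h₁ V G h hmono hG (fun p => A (p + 1)) E (fun p => hAE _)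
        (fun q p hqp => hAA _ _ (Nat.succ_lt_succ hqp)) (fun p => hA _) s S' hS' ?_
      rwa [seqDrop_seqDrop]

theorem exists_canClear (k : ℕ) {ω : ℕ} (hω : 1 ≤ ω) : ∀ r, ∃ t, CanClear.{u} k ω r t := by
  induction ω, hω using Nat.le_induction with
  | base => exact fun r => ⟨_, canClear_one k r⟩
  | succ ω hω ih =>
    intro r
    obtain ⟨t, ht⟩ := exists_clear_layers ih (r 0) (seqTail r)
    refine ⟨t + 1, fun V _ _ G h hmono hG A E hAE hA s S hS hwin => ?_⟩
    have hR : IsChordalOrder fun i j => BackAdj G h i j ∧ i ∈ A ∪ E ∧ j ∈ A ∪ E :=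
      BackAdj.isChordalOrder hG _
    set R : ℕ → ℕ → Prop := fun i j => BackAdj G h i j ∧ i ∈ A ∪ E ∧ j ∈ A ∪ E
    rw [Nat.add_right_comm]
    refine WinsOn.restrict (fun x => (depthIn R A (h x) : ℤ)) (fun x hx y hy hxy => ?_) fun a => ?_
    · rcases backAdj_or_eq_or h hxy with hb | hb | hb
      · exact hR.abs_depthIn_sub_le A ⟨hb, hS x hx, hS y hy⟩
      · simp [hb]
      · rw [abs_sub_comm]
        exact hR.abs_depthIn_sub_le A ⟨hb, hS y hy, hS x hx⟩
    -- Preserver keeps depths `a, …, a + r 0 - 1`; each of these is one layer of `A`.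
    refine ht V G h hmono hG (fun p => {i | i ∈ A ∧ (depthIn R A i : ℤ) = a + p}) E
      (fun p i hi j hj => hAE i hi j hj.1) ?_ ?_ s _ ?_ ?_
    · rintro q p hqp i ⟨hiA, hi⟩ j ⟨hjA, hj⟩ hij
      have := hR.depthIn_mono A ⟨hij, Or.inl hiA, Or.inl hjA⟩ hjA
      omega
    · rintro p j ⟨hjA, hj⟩
      rcases Set.eq_empty_or_nonempty
        {i | i ∈ {i | i ∈ A ∧ (depthIn R A i : ℤ) = a + p} ∧ BackAdj G h i j} with he | ⟨i, hi, hij⟩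
      · rw [he, Set.ncard_empty]
        omega
      -- The lower neighbour `z` has depth one less than `j`, so it is outside the layer of `j` and
      -- the count drops.
      · obtain ⟨z, hz, hjz⟩ := hR.exists_depthIn_add_one A ⟨hij, Or.inl hi.1, Or.inl hjA⟩ hjA
        have hzA : z ∈ A := hz.2.1.resolve_right fun hzE => hAE z hzE j hjA hz.1
        have hlt : {i | i ∈ {i | i ∈ A ∧ (depthIn R A i : ℤ) = a + p} ∧ BackAdj G h i j}.ncard <
            {i | i ∈ A ∧ BackAdj G h i j}.ncard := by
          refine Set.ncard_lt_ncard ⟨fun i hi => ⟨hi.1.1, hi.2⟩, fun hsub => ?_⟩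
            (setOf_backAdj_finite G h A j)
          have : (depthIn R A z : ℤ) = a + p := (hsub ⟨hzA, hz.1⟩).1.2
          omega
        have := hA j hjA
        omega
    · rintro x ⟨hx, hx1, hx2⟩
      refine (hS x hx).imp_left fun hxA => ?_
      refine ⟨((depthIn R A (h x) : ℤ) - a).toNat, by omega, hxA, by omega⟩
    · rwa [← seqDrop_succ]

theorem exists_winsOn_univ {k : ℕ} (hk : 1 ≤ k) (r : ℕ → ℕ) :
    ∃ t, ∀ (V : Type u) [LinearOrder V] [Finite V] (G : SimpleGraph V) (h : V → ℕ),
      (∀ x y, x ≤ y → h x ≤ h y) → IsThinPartition G h k → WinsOn G t Set.univ r := by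
  obtain ⟨t, ht⟩ := exists_canClear k hk r
  refine ⟨t, fun V _ _ G h hmono hG => ?_⟩
  -- With `ω = k`, all parts are cleared at once and nothing is left to play afterwards.
  refine ht V G h hmono hG Set.univ ∅ (by simp) (fun j _ => ?_) 0 Set.univ (by simp) ?_
  · simpa using hG.ncard_lt j
  · exact fun S' hS' => Set.eq_empty_of_forall_notMem hS'

/-! ### Thin partitions of graphs without a complete minor -/

/-- Some edge of `G` joins `X` to `Y`. -/
def SetsAdj {V : Type u} (G : SimpleGraph V) (X Y : Set V) : Prop :=
  ∃ x ∈ X, ∃ y ∈ Y, G.Adj x y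

theorem SetsAdj.symm {V : Type u} {G : SimpleGraph V} {X Y : Set V} (h : SetsAdj G X Y) :
    SetsAdj G Y X := by
  obtain ⟨x, hx, y, hy, hxy⟩ := h
  exact ⟨y, hy, x, hx, hxy.symm⟩

theorem isMinor_completeGraph_of_family {V : Type u} {G : SimpleGraph V} {ι : Type v} {k : ℕ}
    (T : Set ι) (hT : T.Finite) (hk : k ≤ T.ncard) (B : ι → Set V)
    (hconn : ∀ i ∈ T, (G.induce (B i)).Connected)
    (hdisj : ∀ i ∈ T, ∀ j ∈ T, i ≠ j → Disjoint (B i) (B j))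
    (hadj : ∀ i ∈ T, ∀ j ∈ T, i ≠ j → SetsAdj G (B i) (B j)) :
    IsMinor (SimpleGraph.completeGraph (Fin k)) G := by
  have := hT.fintype
  obtain ⟨f⟩ : Nonempty (Fin k ↪ T) := Function.Embedding.nonempty_of_card_le <| by
    rw [Fintype.card_fin, ← Nat.card_eq_fintype_card]
    exact hk
  have hf : ∀ {x y}, x ≠ y → (f x).1 ≠ (f y).1 := fun hxy e => hxy (f.injective (Subtype.ext e))
  exact ⟨fun x => B (f x), fun x => hconn _ (f x).2,
    fun x y hxy => hdisj _ (f x).2 _ (f y).2 (hf hxy),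
    fun x y hxy => hadj _ (f x).2 _ (f y).2 (hf hxy.ne)⟩

theorem ncard_adj_parts_lt {V : Type u} {G : SimpleGraph V} {k n : ℕ}
    (hG : ¬ IsMinor (SimpleGraph.completeGraph (Fin k)) G) (h : V → ℕ)
    (hconn : ∀ i < n, (G.induce (h ⁻¹' {i})).Connected) {C : Set V} (hC : (G.induce C).Connected)
    (hCn : ∀ x ∈ C, n ≤ h x)
    (hpair : ∀ i j, i < j → j < n → SetsAdj G (h ⁻¹' {i}) C → SetsAdj G (h ⁻¹' {j}) C →
      SetsAdj G (h ⁻¹' {i}) (h ⁻¹' {j})) :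
    {i | i < n ∧ SetsAdj G (h ⁻¹' {i}) C}.ncard + 1 < k := by
  by_contra! hk
  set N := {i | i < n ∧ SetsAdj G (h ⁻¹' {i}) C} with hN
  have hfin : N.Finite := (Set.finite_lt_nat n).subset fun _ hi => hi.1
  have hn : n ∉ N := fun hn => lt_irrefl _ hn.1
  rw [← Set.ncard_insert_of_notMem hn hfin] at hk
  have hCdisj : ∀ i < n, Disjoint (h ⁻¹' {i}) C := fun i hi =>
    Set.disjoint_left.2 fun x (hx : h x = i) hxC => by
      have := hCn x hxC
      omega
  -- The index `n`, which is not in `N`, stands for `C`.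
  refine hG (isMinor_completeGraph_of_family (insert n N) (hfin.insert n) hk
    (fun i => if i < n then h ⁻¹' {i} else C) ?_ ?_ ?_)
  · rintro i (rfl | hi)
    · rwa [if_neg (lt_irrefl _)]
    · rw [if_pos hi.1]
      exact hconn i hi.1
  · rintro i (rfl | hi) j (rfl | hj) hij
    · exact absurd rfl hij
    · simpa [hj.1] using (hCdisj j hj.1).symm
    · simpa [hi.1] using hCdisj i hi.1
    · simp only [hi.1, hj.1, if_true]
      exact Set.disjoint_left.2 fun x (hx : h x = i) (hx' : h x = j) => hij (hx.symm.trans hx')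
  · rintro i (rfl | hi) j (rfl | hj) hij
    · exact absurd rfl hij
    · simpa [hj.1] using hj.2.symm
    · simpa [hi.1] using hi.2
    · simp only [hi.1, hj.1, if_true]
      rcases lt_or_gt_of_ne hij with hlt | hlt
      · exact hpair i j hlt hj.1 hi.2 hj.2
      · exact (hpair j i hlt hi.1 hj.2 hi.2).symm

/-- Vertex sets of geodesics starting in `a`. -/
theorem exists_geodesic {V : Type u} {G : SimpleGraph V} {a : V} (n : ℕ) :
    ∀ b, G.Reachable a b → G.dist a b = n → ∃ P : Set V, a ∈ P ∧ b ∈ P ∧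
      (G.induce P).Connected ∧ (∀ p ∈ P, G.Reachable a p ∧ G.dist a p ≤ n) ∧
      Set.InjOn (G.dist a) P := by
  induction n with
  | zero =>
    intro b hab hd
    obtain rfl := hab.dist_eq_zero_iff.1 hd
    refine ⟨{a}, rfl, rfl, ?_, ?_, Set.injOn_singleton _ _⟩
    · exact SimpleGraph.induce_connected_of_patches a rfl fun {v} hv =>
        ⟨{a}, subset_rfl, rfl, hv, by obtain rfl := hv; exact SimpleGraph.Reachable.refl _⟩
    · rintro p rfl
      exact ⟨SimpleGraph.Reachable.refl _, by simp⟩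
  | succ n ih =>
    intro b hab hd
    obtain ⟨p, hp⟩ := hab.symm.exists_walk_length_eq_dist
    rw [SimpleGraph.dist_comm, hd] at hp
    cases p with
    | nil => simp at hp
    | @cons _ c _ hbc q =>
      have hca : G.Reachable a c := q.reachable.symm
      have hdc : G.dist a c = n := by
        have h1 : G.dist a c ≤ n := by
          rw [SimpleGraph.dist_comm]
          refine (SimpleGraph.dist_le q).trans ?_
          simpa using hp.le
        have h2 := hbc.diff_dist_adj (u := a)
        omega
      obtain ⟨P, haP, hcP, hconn, hle, hinj⟩ := ih c hca hdc
      have hbP : b ∉ P := fun hb => by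
        have := (hle b hb).2
        omega
      refine ⟨P ∪ {b, c}, Or.inl haP, Or.inr (Or.inl rfl), ?_, ?_, ?_⟩
      · exact SimpleGraph.induce_union_connected hconn.preconnected
          (SimpleGraph.induce_pair_connected_of_adj hbc).preconnected
          ⟨c, hcP, Or.inr rfl⟩
      · rintro x (hx | rfl | rfl)
        · exact ⟨(hle x hx).1, (hle x hx).2.trans n.le_succ⟩
        · exact ⟨hab, hd.le⟩
        · exact ⟨hca, by omega⟩
      · have hP : P ∪ {b, c} = insert b P := by
          ext x
          simp only [Set.mem_union, Set.mem_insert_iff, Set.mem_singleton_iff]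
          constructor
          · rintro (h | h | rfl)
            exacts [Or.inr h, Or.inl h, Or.inr hcP]
          · rintro (h | h)
            exacts [Or.inr (Or.inl h), Or.inl h]
        rw [hP, Set.injOn_insert hbP]
        refine ⟨hinj, ?_⟩
        rintro ⟨x, hx, hxb⟩
        have := (hle x hx).2
        omega

/-- The edges of `G` with both ends in `U`. -/
def edgesWithin {V : Type u} (G : SimpleGraph V) (U : Set V) : SimpleGraph V where
  Adj x y := G.Adj x y ∧ x ∈ U ∧ y ∈ U
  symm := ⟨fun _ _ h => ⟨h.1.symm, h.2.2, h.2.1⟩⟩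
  loopless := ⟨fun _ h => h.1.ne rfl⟩

theorem edgesWithin_le {V : Type u} (G : SimpleGraph V) (U : Set V) : edgesWithin G U ≤ G :=
  fun _ _ h => h.1

theorem mem_of_reachable_edgesWithin {V : Type u} {G : SimpleGraph V} {U : Set V} {x y : V}
    (hx : x ∈ U) (h : (edgesWithin G U).Reachable x y) : y ∈ U := by
  obtain ⟨p⟩ := h
  induction p with
  | nil => exact hx
  | cons hxy _ ih => exact ih hxy.2.2

theorem reachable_edgesWithin {V : Type u} {G : SimpleGraph V} {U X : Set V} (hX : X ⊆ U)
    (hconn : (G.induce X).Connected) {x y : V} (hx : x ∈ X) (hy : y ∈ X) :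
    (edgesWithin G U).Reachable x y :=
  (hconn.preconnected ⟨x, hx⟩ ⟨y, hy⟩).map
    (⟨Subtype.val, fun {a b} h => ⟨h, hX a.2, hX b.2⟩⟩ : G.induce X →g edgesWithin G U)

/-- A connected part `B` of `G[U]` to split off: it lies in a component `C`, it contains a vertex
of each of the sets `W i`, and it meets every layer of a layering of `G[U]` in few vertices. -/
theorem exists_geodesic_union {V : Type u} [Finite V] (G : SimpleGraph V) (U : Set V) {x₀ : V}
    {C : Set V} (hC : C = {y | (edgesWithin G U).Reachable x₀ y}) {N : Set ℕ} (hN : N.Finite)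
    (W : ℕ → Set V) (hW : ∀ i ∈ N, ∃ y ∈ C, y ∈ W i) :
    ∃ B ⊆ C, (G.induce B).Connected ∧ (∀ i ∈ N, ∃ y ∈ B, y ∈ W i) ∧
      ∀ n : ℕ, {x | x ∈ B ∧ (edgesWithin G U).dist x₀ x = n}.ncard ≤ N.ncard + 1 := by
  set Γ := edgesWithin G U
  subst hC
  have hP : ∀ i, ∃ P : Set V, i ∈ N → x₀ ∈ P ∧ (∃ y ∈ P, y ∈ W i) ∧ (G.induce P).Connected ∧
      (∀ p ∈ P, Γ.Reachable x₀ p) ∧ Set.InjOn (Γ.dist x₀) P := by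
    intro i
    by_cases hi : i ∈ N
    · obtain ⟨y, hy, hyW⟩ := hW i hi
      obtain ⟨P, h1, h2, h3, h4, h5⟩ := exists_geodesic _ y hy rfl
      exact ⟨P, fun _ => ⟨h1, ⟨y, h2, hyW⟩,
        h3.mono (SimpleGraph.comap_monotone _ (edgesWithin_le G U)), fun p hp => (h4 p hp).1, h5⟩⟩
    · exact ⟨∅, fun h => absurd h hi⟩
  choose P hP using hP
  -- Adding `x₀` keeps the set non-empty when `N` is empty; this costs the `+ 1` in the bound.
  refine ⟨{x | x = x₀ ∨ ∃ i ∈ N, x ∈ P i}, ?_, ?_, ?_, ?_⟩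
  · rintro x (rfl | ⟨i, hi, hx⟩)
    · exact SimpleGraph.Reachable.refl _
    · exact (hP i hi).2.2.2.1 x hx
  · refine SimpleGraph.induce_connected_of_patches x₀ (Or.inl rfl) ?_
    rintro v (rfl | ⟨i, hi, hv⟩)
    · exact ⟨{v}, by rintro x rfl; exact Or.inl rfl, rfl, rfl, SimpleGraph.Reachable.refl _⟩
    · exact ⟨P i, fun x hx => Or.inr ⟨i, hi, hx⟩, (hP i hi).1, hv,
        (hP i hi).2.2.1.preconnected _ _⟩
  · intro i hi
    obtain ⟨y, hy, hyW⟩ := (hP i hi).2.1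
    exact ⟨y, Or.inr ⟨i, hi, hy⟩, hyW⟩
  · intro n
    -- A geodesic from `x₀` has at most one vertex at distance `n`.
    have hg : ∀ i, ∃ y, i ∈ N → ∀ x ∈ P i, Γ.dist x₀ x = n → x = y := by
      intro i
      by_cases hex : ∃ y ∈ P i, Γ.dist x₀ y = n
      · obtain ⟨y, hy, hyn⟩ := hex
        exact ⟨y, fun hi x hx hxn => (hP i hi).2.2.2.2 hx hy (hxn.trans hyn.symm)⟩
      · exact ⟨x₀, fun _ x hx hxn => absurd ⟨x, hx, hxn⟩ hex⟩
    choose g hg using hg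
    have hsub : {x | (x = x₀ ∨ ∃ i ∈ N, x ∈ P i) ∧ Γ.dist x₀ x = n} ⊆ insert x₀ (g '' N) := by
      rintro x ⟨rfl | ⟨i, hi, hx⟩, hxn⟩
      · exact Or.inl rfl
      · exact Or.inr ⟨i, hi, (hg i hi x hx hxn).symm⟩
    calc _ ≤ _ := Set.ncard_le_ncard hsub (Set.toFinite _)
      _ ≤ _ := Set.ncard_insert_le _ _
      _ ≤ _ := Nat.add_le_add_right (Set.ncard_image_le hN) 1

/-- The vertices with `h x < n` form the first `n` parts of a thin partition whose parts are
connected, and the parts joined to a connected set of other vertices are pairwise joined. -/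
structure IsPartialPartition {V : Type u} (G : SimpleGraph V) (h : V → ℕ) (k n : ℕ) : Prop where
  le : ∀ x, h x ≤ n
  connected : ∀ i < n, (G.induce (h ⁻¹' {i})).Connected
  joined : ∀ X : Set V, (∀ x ∈ X, h x = n) → (G.induce X).Connected → ∀ i j, i < j → j < n →
    SetsAdj G (h ⁻¹' {i}) X → SetsAdj G (h ⁻¹' {j}) X → SetsAdj G (h ⁻¹' {i}) (h ⁻¹' {j})
  chordal : ∀ i j l, l < n → BackAdj G h i l → BackAdj G h j l → i < j → BackAdj G h i j
  ncard_lt : ∀ l < n, {i | BackAdj G h i l}.ncard < k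
  layering : ∀ i < n, ∃ lam : V → ℤ,
    (∀ x y, i ≤ h x → i ≤ h y → G.Adj x y → |lam x - lam y| ≤ 1) ∧
    ∀ m, {x | h x = i ∧ lam x = m}.ncard ≤ k

theorem backAdj_iff {V : Type u} {G : SimpleGraph V} {h : V → ℕ} {i j : ℕ} :
    BackAdj G h i j ↔ i < j ∧ SetsAdj G (h ⁻¹' {i}) (h ⁻¹' {j}) :=
  and_congr_right fun _ => ⟨fun ⟨x, y, hx, hy, hxy⟩ => ⟨x, hx, y, hy, hxy⟩,
    fun ⟨x, hx, y, hy, hxy⟩ => ⟨x, y, hx, hy, hxy⟩⟩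

open Classical in
-- The new part is a union of geodesics in the component of `x₀`, reaching every earlier part joined
-- to that component. This keeps `joined` true for the vertices left over.
theorem IsPartialPartition.extend {V : Type u} [Finite V] {G : SimpleGraph V} {h : V → ℕ}
    {k n : ℕ} (hk : ¬ IsMinor (SimpleGraph.completeGraph (Fin k)) G)
    (hG : IsPartialPartition G h k n) {x₀ : V} (hx₀ : h x₀ = n) :
    ∃ h' : V → ℕ, IsPartialPartition G h' k (n + 1) ∧
      {x | h' x = n + 1}.ncard < {x | h x = n}.ncard := by
  set U := {x | h x = n} with hU
  set Γ := edgesWithin G U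
  set C := {y | Γ.Reachable x₀ y} with hC
  have hCU : C ⊆ U := fun y hy => mem_of_reachable_edgesWithin hx₀ hy
  have hCconn : (G.induce C).Connected := by
    refine SimpleGraph.induce_connected_of_patches x₀ (SimpleGraph.Reachable.refl _) ?_
    intro v hv
    obtain ⟨P, h1, h2, h3, h4, -⟩ := exists_geodesic _ v hv rfl
    exact ⟨P, fun p hp => (h4 p hp).1, h1, h2,
      (h3.mono (SimpleGraph.comap_monotone _ (edgesWithin_le G U))).preconnected _ _⟩
  set N := {i | i < n ∧ SetsAdj G (h ⁻¹' {i}) C} with hN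
  have hNfin : N.Finite := (Set.finite_lt_nat n).subset fun _ hi => hi.1
  have hNk : N.ncard + 1 < k := ncard_adj_parts_lt hk h hG.connected hCconn
    (fun x hx => (hCU hx).ge) (hG.joined C hCU hCconn)
  obtain ⟨B, hBC, hBconn, hBN, hBcard⟩ := exists_geodesic_union G U hC hNfin
    (fun i => {y | ∃ x, h x = i ∧ G.Adj x y}) (by
      rintro i ⟨-, x, hx, y, hy, hxy⟩
      exact ⟨y, hy, x, hx, hxy⟩)
  have hBU : ∀ x ∈ B, h x = n := fun x hx => hCU (hBC hx)
  have hBN' : ∀ i ∈ N, SetsAdj G (h ⁻¹' {i}) B := by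
    intro i hi
    obtain ⟨y, hy, x, hx, hxy⟩ := hBN i hi
    exact ⟨x, hx, y, hy, hxy⟩
  set h' : V → ℕ := fun x => if h x = n ∧ x ∉ B then n + 1 else h x with hh'
  have hlt : ∀ i < n, h' ⁻¹' {i} = h ⁻¹' {i} := by
    intro i hi
    ext x
    simp only [hh', Set.mem_preimage, Set.mem_singleton_iff]
    split_ifs with hx
    · omega
    · rfl
  have hn : h' ⁻¹' {n} = B := by
    ext x
    simp only [hh', Set.mem_preimage, Set.mem_singleton_iff]
    split_ifs with hx
    · simp [hx.2]
    · exact ⟨fun hxn => by tauto, hBU x⟩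
  have hsucc : ∀ x, h' x = n + 1 → h x = n ∧ x ∉ B := by
    intro x hx
    by_contra hcon
    simp only [hh', hcon, if_false] at hx
    have := hG.le x
    omega
  have hge : ∀ i ≤ n, ∀ x, i ≤ h' x → i ≤ h x := by
    intro i hi x hx
    simp only [hh'] at hx
    split_ifs at hx <;> omega
  have hback : ∀ i j, j < n → (BackAdj G h' i j ↔ BackAdj G h i j) := by
    intro i j hj
    rw [backAdj_iff, backAdj_iff]
    refine and_congr_right fun hij => ?_
    rw [hlt i (hij.trans hj), hlt j hj]
  have hbackn : ∀ i, BackAdj G h' i n → i ∈ N := by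
    intro i hi
    obtain ⟨hin, hadj⟩ := backAdj_iff.1 hi
    rw [hlt i hin, hn] at hadj
    obtain ⟨x, hx, y, hy, hxy⟩ := hadj
    exact ⟨hin, x, hx, y, hBC hy, hxy⟩
  refine ⟨h', ⟨?_, ?_, ?_, ?_, ?_, ?_⟩, ?_⟩
  · intro x
    have := hG.le x
    simp only [hh']
    split_ifs <;> omega
  · intro i hi
    rcases Nat.lt_succ_iff_lt_or_eq.1 hi with hi | rfl
    · rw [hlt i hi]
      exact hG.connected i hi
    · rwa [hn]
  · intro X hX hXconn i j hij hj hiX hjX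
    have hXU : X ⊆ U := fun x hx => (hsucc x (hX x hx)).1
    rcases Nat.lt_succ_iff_lt_or_eq.1 hj with hj | rfl
    · rw [hlt i (hij.trans hj)] at hiX ⊢
      rw [hlt j hj] at hjX ⊢
      exact hG.joined X hXU hXconn i j hij hj hiX hjX
    · rw [hlt i hij] at hiX ⊢
      rw [hn] at hjX ⊢
      obtain ⟨b, hb, y, hy, hby⟩ := hjX
      obtain ⟨z, hz, x, hx, hzx⟩ := hiX
      -- As `X` is connected and touches `B`, it lies in `C`; hence `i ∈ N`, and `B` was chosen to
      -- touch part `i`.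
      refine hBN' i ⟨hij, z, hz, x, ?_, hzx⟩
      have h1 : Γ.Reachable b y := SimpleGraph.Adj.reachable ⟨hby, hBU b hb, hXU hy⟩
      exact ((hBC hb).trans h1).trans (reachable_edgesWithin hXU hXconn hy hx)
  · intro i j l hl hil hjl hij
    rcases Nat.lt_succ_iff_lt_or_eq.1 hl with hl | rfl
    · rw [hback _ _ hl] at hil hjl
      rw [hback _ _ (hjl.1.trans hl)]
      exact hG.chordal i j l hl hil hjl hij
    · have hjn := hjl.1
      rw [hback _ _ hjn, backAdj_iff]
      exact ⟨hij, hG.joined C hCU hCconn i j hij hjn (hbackn i hil).2 (hbackn j hjl).2⟩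
  · intro l hl
    rcases Nat.lt_succ_iff_lt_or_eq.1 hl with hl | rfl
    · simpa only [hback _ _ hl] using hG.ncard_lt l hl
    · have := Set.ncard_le_ncard (fun i hi => hbackn i hi : {i | BackAdj G h' i l} ⊆ N) hNfin
      omega
  · intro i hi
    rcases Nat.lt_succ_iff_lt_or_eq.1 hi with hi | rfl
    · obtain ⟨lam, h1, h2⟩ := hG.layering i hi
      refine ⟨lam, fun x y hx hy => h1 x y (hge i hi.le x hx) (hge i hi.le y hy), fun m => ?_⟩
      convert h2 m using 4 with x
      exact and_congr_left' (Set.ext_iff.1 (hlt i hi) x)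
    -- Outside `C` the distance takes its default value `0`, which is harmless because no edge of
    -- `Γ` leaves `C`.
    · refine ⟨fun x => Γ.dist x₀ x, fun x y hx hy hxy => ?_, fun m => ?_⟩
      · have hxy' : Γ.Adj x y :=
          ⟨hxy, le_antisymm (hG.le x) (hge i le_rfl x hx), le_antisymm (hG.le y) (hge i le_rfl y hy)⟩
        have := hxy'.diff_dist_adj (u := x₀)
        simp only [abs_le]
        omega
      · refine le_trans (Set.ncard_le_ncard ?_ (Set.toFinite _))
          ((hBcard m.toNat).trans hNk.le)
        rintro x ⟨hx, hxm⟩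
        have hxB : x ∈ B := hn ▸ hx
        have hxm' : (Γ.dist x₀ x : ℤ) = m := hxm
        exact ⟨hxB, by rw [← hxm', Int.toNat_natCast]⟩
  · refine Set.ncard_lt_ncard ⟨fun x hx => (hsucc x hx).1, fun hsub => ?_⟩ (Set.toFinite _)
    obtain ⟨b, hb⟩ := hBconn.nonempty
    exact (hsucc b (hsub (hBU b hb))).2 hb

theorem exists_isThinPartition {V : Type u} [Finite V] {G : SimpleGraph V} {k : ℕ} (hk₁ : 1 ≤ k)
    (hk : ¬ IsMinor (SimpleGraph.completeGraph (Fin k)) G) :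
    ∃ h : V → ℕ, IsThinPartition G h k := by
  suffices H : ∀ m n (h : V → ℕ), IsPartialPartition G h k n → {x | h x = n}.ncard = m →
      ∃ h : V → ℕ, IsThinPartition G h k from
    -- With `n = 0` there are no parts yet and every vertex is left over.
    H _ 0 (fun _ => 0) ⟨fun _ => le_rfl, by simp, by simp, by simp, by simp, by simp⟩ rfl
  intro m
  induction m using Nat.strong_induction_on with
  | _ m ih =>
    intro n h hG hm
    by_cases hne : ∃ x₀, h x₀ = n
    · obtain ⟨x₀, hx₀⟩ := hne
      obtain ⟨h', hG', hlt⟩ := hG.extend hk hx₀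
      exact ih _ (hm ▸ hlt) (n + 1) h' hG' rfl
    · push Not at hne
      have hlt : ∀ x, h x < n := fun x => lt_of_le_of_ne (hG.le x) (hne x)
      refine ⟨h, fun i j l hil => ?_, fun l => ?_, fun i => ?_⟩
      · obtain ⟨-, -, y, -, rfl, -⟩ := id hil
        exact hG.chordal i j _ (hlt y) hil
      · by_cases hl : l < n
        · exact hG.ncard_lt l hl
        · have : {i | BackAdj G h i l} = ∅ := by
            refine Set.eq_empty_of_forall_notMem ?_
            rintro i ⟨-, -, y, -, rfl, -⟩
            exact hl (hlt y)
          rw [this, Set.ncard_empty]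
          omega
      · by_cases hi : i < n
        · exact hG.layering i hi
        · refine ⟨fun _ => 0, by simp, fun m => ?_⟩
          have : {x | h x = i ∧ (0 : ℤ) = m} = ∅ := by
            refine Set.eq_empty_of_forall_notMem ?_
            rintro x ⟨rfl, -⟩
            exact hi (hlt x)
          rw [this, Set.ncard_empty]
          omega

/-! ### The ordering and the Baker class -/

/-- A linear ordering along which `h` is monotone. -/
theorem exists_linearOrder_monotone {V : Type u} [Finite V] (h : V → ℕ) :
    ∃ L : LinearOrder V, ∀ x y, L.le x y → h x ≤ h y := by
  obtain ⟨n, ⟨e⟩⟩ := Finite.exists_equiv_fin V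
  let f : V → ℕ ×ₗ Fin n := fun x => toLex (h x, e x)
  have hf : Function.Injective f := fun x y hxy =>
    e.injective (congrArg (fun p => (ofLex p).2) hxy)
  refine ⟨LinearOrder.lift' f hf, fun x y hxy => ?_⟩
  have : f x ≤ f y := hxy
  rcases Prod.Lex.le_iff.1 this with hlt | heq
  · exact hlt.le
  · exact heq.1.le

theorem mainTheorem3 (k : ℕ) (hk : 1 ≤ k) :
    ∃ K : Set OrderedGraph.{u}, IsBakerClass K ∧
      ∀ (V : Type u) (hV : Finite V) (G : SimpleGraph V),
        ¬ IsMinor (SimpleGraph.completeGraph (Fin k)) G →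
          ∃ L : LinearOrder V, OrderedGraph.mk V hV L G ∈ K := by
  refine ⟨{G | ∃ h : G.V → ℕ, (∀ x y, G.ord.le x y → h x ≤ h y) ∧ IsThinPartition G.graph h k},
    fun r => ?_, fun V hV G hG => ?_⟩
  · obtain ⟨t, ht⟩ := exists_winsOn_univ hk r
    refine ⟨t, ?_⟩
    rintro G ⟨h, hmono, hthin⟩
    let _ := G.ord
    have := G.fin
    refine destroyerWins_of_winsOn t G id r (fun _ _ => Iff.rfl) (fun _ _ => id) ?_
    rw [Set.range_id]
    exact ht G.V G.graph h hmono hthin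
  · obtain ⟨h, hthin⟩ := exists_isThinPartition hk hG
    obtain ⟨L, hL⟩ := exists_linearOrder_monotone h
    exact ⟨L, h, hL, hthin⟩
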